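/- Let $\chi\le\theta\le\kappa$ be infinite regular cardinals with $\max\{\chi,\aleph_1\}<\kappa$, and suppose that $\square(\kappa)$ holds. Then $\mathrm{U}_1(\kappa,2,\theta,\chi)$ holds. Here, for a set of ordinals $C$, $\mathrm{acc}(C)$ denotes the set of all $\delta\in C$ with $\sup(C\cap\delta)=\delta>0$. The principle $\square(\kappa)$ asserts the existence of a sequence $\langle C_\alpha\mid\alpha<\kappa\rangle$ such that: (1) for every $\alpha<\kappa$, $C_\alpha$ is a closed subset of $\alpha$ with $\sup(C_\alpha)=\sup(\alpha)$; (2) for all $\alpha<\kappa$ and $\delta\in\mathrm{acc}(C_\alpha)$, $C_\alpha\cap\delta=C_\delta$; (3) there is no club $C$ in $\kappa$ such that $C\cap\alpha=C_\alpha$ for all $\alpha\in\mathrm{acc}(C)$. The principle $\mathrm{U}_1(\kappa,2,\theta,\chi)$ asserts the existence of a coloring $c:\{(\alpha,\beta)\mid\alpha<\beta<\kappa\}\to\theta$ such that for every ordinal $\sigma<\chi$, every pairwise disjoint family $\mathcal A$ of size $\kappa$ consisting of subsets of $\kappa$ of order type $\sigma$, and every ordinal $\epsilon<\theta$, there are $a,b\in\mathcal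 A$ with $a<b$ (that is, $\alpha<\beta$ for all $\alpha\in a$ and $\beta\in b$) and an ordinal $\tau>\epsilon$ such that $c[a\times b]=\{\tau\}$. -/

import Mathlib

universe u

/-- The ordinal `δ` is an accumulation point of the set of ordinals `C`: `sup (C ∩ δ) = δ > 0`. -/
def IsAccPt (C : Set Ordinal.{u}) (δ : Ordinal.{u}) : Prop :=
  0 < δ ∧ sSup (C ∩ Set.Iio δ) = δ

/-- The set `acc(C)` of accumulation points of a set of ordinals `C` that belong to `C`. -/
def accPts (C : Set Ordinal.{u}) : Set Ordinal.{u} :=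
  {δ | δ ∈ C ∧ IsAccPt C δ}

/-- `C` is a closed subset of the ordinal `α` (in the order topology of `α`) and
`sup C = sup α`. Here `sup 0 = 0`, `sup (β + 1) = β`, and `sup α = α` for `α` a limit. -/
structure IsLadder (C : Set Ordinal.{u}) (α : Ordinal.{u}) : Prop where
  subset : C ⊆ Set.Iio α
  closed : ∀ δ < α, IsAccPt C δ → δ ∈ C
  sup_eq : sSup C = sSup (Set.Iio α)

/-- `C` is a closed and unbounded subset of the cardinal `κ`. -/
structure IsClubIn (C : Set Ordinal.{u}) (κ : Cardinal.{u}) : Prop where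
  subset : C ⊆ Set.Iio κ.ord
  closed : ∀ δ < κ.ord, IsAccPt C δ → δ ∈ C
  unbounded : ∀ α < κ.ord, ∃ β ∈ C, α ≤ β

/-- The principle `□(κ, <μ)`. -/
def SquareLT (κ μ : Cardinal.{u}) : Prop :=
  ∃ 𝒞 : Ordinal.{u} → Set (Set Ordinal.{u}),
    (∀ α < κ.ord, (𝒞 α).Nonempty ∧ Cardinal.mk (𝒞 α) < Cardinal.lift.{u + 1} μ ∧
      ∀ C ∈ 𝒞 α, IsLadder C α) ∧
    (∀ α < κ.ord, ∀ C ∈ 𝒞 α, ∀ δ ∈ accPts C, C ∩ Set.Iio δ ∈ 𝒞 δ) ∧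
    ¬ ∃ C : Set Ordinal.{u}, IsClubIn C κ ∧ ∀ α ∈ accPts C, C ∩ Set.Iio α ∈ 𝒞 α

/-- The principle `□(κ)`, which is `□(κ, <2)`. -/
def Square (κ : Cardinal.{u}) : Prop :=
  SquareLT κ 2

/-- `𝒜` is a pairwise disjoint subfamily of `[κ]^σ` of size `κ`, where `[κ]^σ` is the collection
of all subsets of `κ` of order type `σ`. -/
structure IsDisjointFamily (κ : Cardinal.{u}) (σ : Ordinal.{u})
    (𝒜 : Set (Set Ordinal.{u})) : Prop where
  subset : ∀ a ∈ 𝒜, a ⊆ Set.Iio κ.ord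
  otp_eq : ∀ a ∈ 𝒜, Ordinal.type (fun x y : a => x < y) = Ordinal.lift.{u + 1} σ
  disjoint : 𝒜.PairwiseDisjoint id
  card_eq : Cardinal.mk 𝒜 = Cardinal.lift.{u + 1} κ

/-- The principle `U₁(κ, 2, θ, χ)`. The coloring of `[κ]² = {(α, β) | α < β < κ}` is given by a
function of two ordinals of which only the values at `α < β < κ` matter. An element of `[𝒜]²` is
a pair `(a, b)` of members of `𝒜` with `a < b`, that is, `α < β` for all `α ∈ a` and `β ∈ b`. -/
def UOneTwo (κ θ χ : Cardinal.{u}) : Prop :=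
  ∃ c : Ordinal.{u} → Ordinal.{u} → Ordinal.{u},
    (∀ α β, α < β → β < κ.ord → c α β < θ.ord) ∧
    ∀ σ < χ.ord, ∀ 𝒜 : Set (Set Ordinal.{u}), IsDisjointFamily κ σ 𝒜 →
      ∀ ε < θ.ord, ∃ a ∈ 𝒜, ∃ b ∈ 𝒜, (∀ α ∈ a, ∀ β ∈ b, α < β) ∧
        ∃ τ > ε, Function.uncurry c '' (a ×ˢ b) = {τ}

/-! Colour (α, β) by walking from β down to α along a □(κ)-sequence C. Each step τ with C τ ∩ α
bounded below α contributes the pair (index of C τ ∩ α, next step), and `walkMax` is the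
lexicographic maximum of these pairs. The colour is its first coordinate if θ < κ; if θ = κ it is
the second, and χ many indices suffice.

The indices come from the absence of a thread (`exists_index`). Suppose every level ζ had fewer than
θ traces C γ ∩ ζ that occur for stationarily many γ. At levels of cofinality θ they would already
differ below some bound, Fodor's lemma would make the bound uniform, and one trace would extend
uniquely to a thread. So some level ζ₀ has θ such traces; they serve as indices, each taken
stationarily often.

For a constant rectangle (`exists_walkMax_eq`), find δ below some b ∈ 𝒜 such that the walks from b
to δ have indices at most e, and γ a limit of members a of 𝒜 such that the walks from γ to a, and C
γ itself, have indices at most e'. The bounds e, e' are fixed first. Then take i above ε, e, e' and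
ν of index i with γ < ν < δ. The walk from δ to γ decomposes at ν (`exists_walkSup_eq`), and γ ∉
acc(C ν) because the indices differ, so the step from ν contributes i. This dominates both outer
parts, and `walkMax` is constantly `walkMax C idx γ δ` on a × b, with first coordinate above ε and
second at least γ. -/

/-- A set of ordinals is stationary in `κ` if it contains, for every function from `κ` to `κ`,
a positive ordinal below `κ` closed under that function. -/
def StatIn (κ : Cardinal.{u}) (E : Set Ordinal.{u}) : Prop :=
  ∀ F : Ordinal.{u} → Ordinal.{u}, (∀ ξ < κ.ord, F ξ < κ.ord) →
    ∃ γ ∈ E, γ < κ.ord ∧ 0 < γ ∧ ∀ ξ < γ, F ξ < γ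

/-! ### Bounds below regular cardinals -/

theorem exists_lt_forall_le_of_lt_cof {o : Ordinal.{u}} {ι : Type (u + 1)} (f : ι → Ordinal.{u})
    (hι : Cardinal.mk ι < Cardinal.lift.{u + 1} o.cof) (hf : ∀ i, f i < o) :
    ∃ b < o, ∀ i, f i ≤ b := by
  refine ⟨sSup (Set.range f), Ordinal.sSup_lt_of_lt_cof ?_ (by simpa using hf), fun i => ?_⟩
  · rw [← Ordinal.lift_cof]
    exact Cardinal.mk_range_le.trans_lt hι
  · exact le_csSup ⟨o, by rintro _ ⟨j, rfl⟩; exact (hf j).le⟩ ⟨i, rfl⟩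

theorem exists_lt_ord_forall_le {κ : Cardinal.{u}} (hκ : κ.IsRegular) {ι : Type (u + 1)}
    (f : ι → Ordinal.{u}) (hι : Cardinal.mk ι < Cardinal.lift.{u + 1} κ)
    (hf : ∀ i, f i < κ.ord) : ∃ b < κ.ord, ∀ i, f i ≤ b :=
  exists_lt_forall_le_of_lt_cof f (by rwa [hκ.cof_ord]) hf

theorem mk_Iio_lt_lift {κ : Cardinal.{u}} {ξ : Ordinal.{u}} (h : ξ < κ.ord) :
    Cardinal.mk (Set.Iio ξ) < Cardinal.lift.{u + 1} κ := by
  rw [Cardinal.mk_Iio_ordinal, Cardinal.lift_lt]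
  exact Cardinal.lt_ord.1 h

theorem mk_Iic_lt_lift {κ : Cardinal.{u}} (hκ : κ.IsRegular) {ξ : Ordinal.{u}} (h : ξ < κ.ord) :
    Cardinal.mk (Set.Iic ξ) < Cardinal.lift.{u + 1} κ := by
  rw [← Order.Iio_succ]
  exact mk_Iio_lt_lift ((Cardinal.isSuccLimit_ord hκ.aleph0_le).succ_lt h)

theorem mk_Iio_ord (κ : Cardinal.{u}) :
    Cardinal.mk (Set.Iio κ.ord) = Cardinal.lift.{u + 1} κ := by
  rw [Cardinal.mk_Iio_ordinal, Cardinal.card_ord]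

/-! ### Stationary sets and Fodor's lemma -/

namespace StatIn

variable {κ : Cardinal.{u}} {E E' : Set Ordinal.{u}}

theorem mono (hE : StatIn κ E) (h : E ⊆ E') : StatIn κ E' := fun F hF =>
  let ⟨γ, hγ, h'⟩ := hE F hF
  ⟨γ, h hγ, h'⟩

theorem exists_closed_gt (hE : StatIn κ E) (hκ : κ.IsRegular) {F : Ordinal.{u} → Ordinal.{u}}
    (hF : ∀ ξ < κ.ord, F ξ < κ.ord) {η : Ordinal.{u}} (hη : η < κ.ord) :
    ∃ γ ∈ E, γ < κ.ord ∧ η < γ ∧ Order.IsSuccLimit γ ∧ ∀ ξ < γ, F ξ < γ := by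
  have hl := Cardinal.isSuccLimit_ord hκ.aleph0_le
  -- Closure under successor makes γ a limit; the constant η, applied at 0 < γ, puts γ above η.
  obtain ⟨γ, hγ, hγκ, h0, hcl⟩ := hE (fun ξ => max (max η (Order.succ ξ)) (F ξ))
    fun ξ hξ => max_lt (max_lt hη (hl.succ_lt hξ)) (hF ξ hξ)
  have hcl' : ∀ ξ < γ, η < γ ∧ Order.succ ξ < γ ∧ F ξ < γ := fun ξ hξ => by
    have := hcl ξ hξ
    simp only [max_lt_iff] at this
    tauto
  refine ⟨γ, hγ, hγκ, (hcl' 0 h0).1, ?_, fun ξ hξ => (hcl' ξ hξ).2.2⟩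
  rw [Order.isSuccLimit_iff, Order.isSuccPrelimit_iff_succ_lt]
  exact ⟨by simpa using h0.ne', fun ξ hξ => (hcl' ξ hξ).2.1⟩

theorem exists_gt (hE : StatIn κ E) (hκ : κ.IsRegular) {η : Ordinal.{u}} (hη : η < κ.ord) :
    ∃ γ ∈ E, γ < κ.ord ∧ η < γ ∧ Order.IsSuccLimit γ :=
  let ⟨γ, h1, h2, h3, h4, _⟩ := hE.exists_closed_gt hκ (F := id) (fun _ h => h) hη
  ⟨γ, h1, h2, h3, h4⟩

theorem inter_Ioo (hE : StatIn κ E) (hκ : κ.IsRegular) {η : Ordinal.{u}} (hη : η < κ.ord) :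
    StatIn κ {γ ∈ E | η < γ ∧ γ < κ.ord ∧ Order.IsSuccLimit γ} := fun _ hF =>
  let ⟨γ, h1, h2, h3, h4, h5⟩ := hE.exists_closed_gt hκ hF hη
  ⟨γ, ⟨h1, h3, h2, h4⟩, h2, pos_of_gt h3, h5⟩

/-- A stationary set partitioned into fewer than `κ` pieces has a stationary piece. -/
theorem exists_fiber (hE : StatIn κ E) (hκ : κ.IsRegular) {T : Type (u + 1)}
    (p : Ordinal.{u} → T) (P : Set T) (hP : Cardinal.mk P < Cardinal.lift.{u + 1} κ)
    (hp : ∀ γ ∈ E, γ < κ.ord → p γ ∈ P) : ∃ t ∈ P, StatIn κ {γ ∈ E | p γ = t} := by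
  by_contra! hcon
  have h1 : ∀ t : P, ∃ F : Ordinal.{u} → Ordinal.{u}, (∀ ξ < κ.ord, F ξ < κ.ord) ∧
      ∀ γ ∈ E, p γ = t → γ < κ.ord → 0 < γ → ∃ ξ < γ, γ ≤ F ξ := fun t => by
    have := hcon t t.2
    unfold StatIn at this
    push Not at this
    obtain ⟨F, hF, h⟩ := this
    exact ⟨F, hF, fun γ h1 h2 h3 h4 => h γ ⟨h1, h2⟩ h3 h4⟩
  choose F hF hFE using h1
  have h2 : ∀ ξ, ∃ b, ξ < κ.ord → b < κ.ord ∧ ∀ t, F t ξ ≤ b := fun ξ => by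
    by_cases hξ : ξ < κ.ord
    · obtain ⟨b, hb, hb'⟩ := exists_lt_ord_forall_le hκ (fun t => F t ξ) hP (fun t => hF t ξ hξ)
      exact ⟨b, fun _ => ⟨hb, hb'⟩⟩
    · exact ⟨0, fun h => absurd h hξ⟩
  -- G dominates the witnesses of nonstationarity of all pieces, so no point of E is closed under G.
  choose G hG using h2
  obtain ⟨γ, hγ, hγκ, h0, hcl⟩ := hE G (fun ξ hξ => (hG ξ hξ).1)
  obtain ⟨ξ, hξ, h⟩ := hFE ⟨p γ, hp γ hγ hγκ⟩ γ hγ rfl hγκ h0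
  exact absurd (hcl ξ hξ) (not_lt.2 (h.trans ((hG ξ (hξ.trans hγκ)).2 _)))

/-- A regressive function on a stationary set is bounded on a stationary subset. -/
theorem exists_bounded_of_regressive (hE : StatIn κ E) (hκ : κ.IsRegular)
    (g : Ordinal.{u} → Ordinal.{u}) (hg : ∀ γ ∈ E, γ < κ.ord → 0 < γ → g γ < γ) :
    ∃ b < κ.ord, StatIn κ {γ ∈ E | g γ ≤ b} := by
  by_contra! hcon
  have h1 : ∀ b, ∃ F : Ordinal.{u} → Ordinal.{u}, b < κ.ord → (∀ ξ < κ.ord, F ξ < κ.ord) ∧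
      ∀ γ ∈ E, g γ ≤ b → γ < κ.ord → 0 < γ → ∃ ξ < γ, γ ≤ F ξ := fun b => by
    by_cases hb : b < κ.ord
    · have := hcon b hb
      unfold StatIn at this
      push Not at this
      obtain ⟨F, hF, h⟩ := this
      exact ⟨F, fun _ => ⟨hF, fun γ h1 h2 h3 h4 => h γ ⟨h1, h2⟩ h3 h4⟩⟩
    · exact ⟨id, fun h => absurd h hb⟩
  choose F hF using h1
  have h2 : ∀ ξ, ∃ b, ξ < κ.ord → b < κ.ord ∧ ∀ t ≤ ξ, ∀ η ≤ ξ, F t η ≤ b := fun ξ => by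
    by_cases hξ : ξ < κ.ord
    · have : ∀ t : Set.Iic ξ, ∃ b < κ.ord, ∀ η : Set.Iic ξ, F t η ≤ b := fun t =>
        exists_lt_ord_forall_le hκ (fun η : Set.Iic ξ => F t η) (mk_Iic_lt_lift hκ hξ)
          (fun η => (hF t (lt_of_le_of_lt t.2 hξ)).1 η (lt_of_le_of_lt η.2 hξ))
      choose b hb hb' using this
      obtain ⟨c, hc, hc'⟩ := exists_lt_ord_forall_le hκ b (mk_Iic_lt_lift hκ hξ) hb
      exact ⟨c, fun _ => ⟨hc, fun t ht η hη => (hb' ⟨t, ht⟩ ⟨η, hη⟩).trans (hc' _)⟩⟩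
    · exact ⟨0, fun h => absurd h hξ⟩
  -- A diagonal intersection: G ξ dominates all F t with t ≤ ξ, on arguments up to ξ.
  choose G hG using h2
  obtain ⟨γ, hγ, hγκ, h0, hcl⟩ := hE G (fun ξ hξ => (hG ξ hξ).1)
  have hgγ := hg γ hγ hγκ h0
  obtain ⟨ξ, hξ, h⟩ := (hF (g γ) (hgγ.trans hγκ)).2 γ hγ le_rfl hγκ h0
  have hm : max ξ (g γ) < γ := max_lt hξ hgγ
  exact absurd (hcl _ hm) (not_lt.2 (h.trans
    ((hG _ (hm.trans hγκ)).2 _ (le_max_right _ _) _ (le_max_left _ _))))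

end StatIn

/-- A strictly increasing sequence whose value at `j` bounds `H` on the earlier values. -/
noncomputable def closureSeq (H : Ordinal.{u} → Ordinal.{u}) (j : Ordinal.{u}) : Ordinal.{u} :=
  ⨆ i : Set.Iio j, max (H (closureSeq H i)) (Order.succ (closureSeq H i))
termination_by j
decreasing_by exact i.2

theorem max_le_closureSeq (H : Ordinal.{u} → Ordinal.{u}) {i j : Ordinal.{u}} (h : i < j) :
    max (H (closureSeq H i)) (Order.succ (closureSeq H i)) ≤ closureSeq H j := by
  rw [closureSeq.eq_def H j]
  exact le_ciSup (f := fun i : Set.Iio j =>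
    max (H (closureSeq H i)) (Order.succ (closureSeq H i))) Ordinal.bddAbove_of_small ⟨i, h⟩

theorem closureSeq_strictMono (H : Ordinal.{u} → Ordinal.{u}) : StrictMono (closureSeq H) :=
  fun _ _ h => Order.succ_le_iff.1 ((le_max_right _ _).trans (max_le_closureSeq H h))

theorem closureSeq_lt_ord {κ : Cardinal.{u}} (hκ : κ.IsRegular) {H : Ordinal.{u} → Ordinal.{u}}
    (hH : ∀ ξ < κ.ord, H ξ < κ.ord) (j : Ordinal.{u}) (hj : j < κ.ord) :
    closureSeq H j < κ.ord := by
  induction j using WellFoundedLT.induction with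
  | ind j ih =>
    obtain ⟨b, hb, h⟩ := exists_lt_ord_forall_le hκ (fun i : Set.Iio j =>
      max (H (closureSeq H i)) (Order.succ (closureSeq H i))) (mk_Iio_lt_lift hj) (fun i => by
        have := ih i i.2 (lt_trans i.2 hj)
        exact max_lt (hH _ this) ((Cardinal.isSuccLimit_ord hκ.aleph0_le).succ_lt this))
    rw [closureSeq.eq_def]
    refine lt_of_le_of_lt (Ordinal.iSup_le h) hb

/-- The supremum of the first μ terms of `closureSeq H`, where H ξ bounds F on [0, ξ], is closed
under F and has cofinality μ. -/
theorem statIn_cof_eq {κ μ : Cardinal.{u}} (hκ : κ.IsRegular) (hμ : μ.IsRegular) (hμκ : μ < κ) :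
    StatIn κ {γ | γ.cof = μ} := by
  intro F hF
  have h2 : ∀ ξ, ∃ b, ξ < κ.ord → b < κ.ord ∧ ∀ η ≤ ξ, F η ≤ b := fun ξ => by
    by_cases hξ : ξ < κ.ord
    · obtain ⟨b, hb, hb'⟩ := exists_lt_ord_forall_le hκ (fun t : Set.Iic ξ => F t)
        (mk_Iic_lt_lift hκ hξ) (fun t => hF t (lt_of_le_of_lt t.2 hξ))
      exact ⟨b, fun _ => ⟨hb, fun η hη => hb' ⟨η, hη⟩⟩⟩
    · exact ⟨0, fun h => absurd h hξ⟩
  choose H hH using h2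
  set g := closureSeq H
  have hg : StrictMono g := closureSeq_strictMono H
  have hl := Cardinal.isSuccLimit_ord hμ.aleph0_le
  have hμo : μ.ord < κ.ord := Cardinal.ord_lt_ord.2 hμκ
  have hle : ∀ i < μ.ord, g i < ⨆ i : Set.Iio μ.ord, g i := fun i hi =>
    (hg (Order.lt_succ i)).trans_le (le_ciSup (f := fun i : Set.Iio μ.ord => g i)
      Ordinal.bddAbove_of_small ⟨_, hl.succ_lt hi⟩)
  obtain ⟨b, hb, hb'⟩ := exists_lt_ord_forall_le hκ (fun i : Set.Iio μ.ord => g i)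
    (mk_Iio_lt_lift hμo) (fun i => closureSeq_lt_ord hκ (fun ξ hξ => (hH ξ hξ).1) i
      (lt_trans i.2 hμo))
  have hsup : (⨆ i : Set.Iio μ.ord, g i) < κ.ord := (Ordinal.iSup_le hb').trans_lt hb
  refine ⟨⨆ i : Set.Iio μ.ord, g i, ?_, hsup, ?_, fun ξ hξ => ?_⟩
  · have := Ordinal.cof_iSup_Iio (a := μ.ord) (f := fun i => g i)
      (fun _ _ h => hg h) hl.isSuccPrelimit
    simpa [hμ.cof_ord] using this
  · exact (zero_le (a := g 0)).trans_lt (hle 0 hμ.ord_pos)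
  · obtain ⟨i, hi⟩ := (Ordinal.lt_iSup_iff).1 hξ
    have h1 : F ξ ≤ H (g i) := (hH _ ((hle i i.2).trans hsup)).2 ξ hi.le
    have h2 : H (g i) ≤ g (Order.succ i) :=
      (le_max_left _ _).trans (max_le_closureSeq H (Order.lt_succ _))
    exact (h1.trans h2).trans_lt (hle _ (hl.succ_lt i.2))

/-! ### Coherent sequences and walks -/

/-- A coherent sequence of ladders on `κ`. -/
structure IsCoherentSeq (κ : Cardinal.{u}) (C : Ordinal.{u} → Set Ordinal.{u}) : Prop where
  ladder : ∀ α < κ.ord, IsLadder (C α) α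
  coherent : ∀ α < κ.ord, ∀ δ ∈ accPts (C α), C α ∩ Set.Iio δ = C δ

theorem Square.exists_coherentSeq {κ : Cardinal.{u}} (h : Square κ) :
    ∃ C : Ordinal.{u} → Set Ordinal.{u}, IsCoherentSeq κ C ∧
      ¬ ∃ D : Set Ordinal.{u}, IsClubIn D κ ∧ ∀ α ∈ accPts D, D ∩ Set.Iio α = C α := by
  obtain ⟨𝒞, h1, h2, h3⟩ := h
  have h4 : ∀ α, ∃ c, α < κ.ord → c ∈ 𝒞 α := fun α => by
    by_cases hα : α < κ.ord
    · obtain ⟨c, hc⟩ := (h1 α hα).1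
      exact ⟨c, fun _ => hc⟩
    · exact ⟨∅, fun h => absurd h hα⟩
  choose C hC using h4
  have hsub : ∀ α < κ.ord, (𝒞 α).Subsingleton := fun α hα => by
    have := (h1 α hα).2.1
    rw [Cardinal.lift_two] at this
    intro a ha b hb
    by_contra hne
    exact absurd this (not_lt.2 (Cardinal.two_le_iff.2
      ⟨⟨a, ha⟩, ⟨b, hb⟩, fun h => hne (congrArg Subtype.val h)⟩))
  have hacc : ∀ {c : Set Ordinal.{u}} {α}, c ⊆ Set.Iio κ.ord → α ∈ accPts c → α < κ.ord :=
    fun hc hα => hc hα.1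
  refine ⟨C, ⟨fun α hα => (h1 α hα).2.2 _ (hC α hα), fun α hα δ hδ => ?_⟩, ?_⟩
  · have hδα : δ < α := ((h1 α hα).2.2 _ (hC α hα)).subset hδ.1
    exact hsub δ (hδα.trans hα) (h2 α hα _ (hC α hα) δ hδ) (hC δ (hδα.trans hα))
  · rintro ⟨D, hD, hD'⟩
    refine h3 ⟨D, hD, fun α hα => ?_⟩
    rw [hD' α hα]
    exact hC α (hacc hD.subset hα)

theorem sSup_inter_Iio_le (c : Set Ordinal.{u}) (δ : Ordinal.{u}) :
    sSup (c ∩ Set.Iio δ) ≤ δ :=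
  csSup_le' fun _ h => h.2.le

theorem le_sSup_inter_Iio {c : Set Ordinal.{u}} {δ ξ : Ordinal.{u}} (h : ξ ∈ c) (h' : ξ < δ) :
    ξ ≤ sSup (c ∩ Set.Iio δ) :=
  le_csSup ⟨δ, fun _ h => h.2.le⟩ ⟨h, h'⟩

theorem IsAccPt.exists_gt {c : Set Ordinal.{u}} {δ α : Ordinal.{u}} (h : IsAccPt c δ)
    (hα : α < δ) : ∃ ξ ∈ c, α < ξ ∧ ξ < δ := by
  by_contra! hcon
  refine absurd h.2 (ne_of_lt (lt_of_le_of_lt (csSup_le' ?_) hα))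
  rintro ξ ⟨hξ, hξδ⟩
  by_contra hlt
  exact absurd hξδ (not_lt.2 (hcon ξ hξ (not_le.1 hlt)))

theorem IsLadder.exists_ge {c : Set Ordinal.{u}} {β α : Ordinal.{u}} (h : IsLadder c β)
    (hβ : Order.IsSuccLimit β) (hα : α < β) : ∃ ξ ∈ c, α ≤ ξ := by
  by_contra! hcon
  have h1 := h.sup_eq
  rw [hβ.isSuccPrelimit.sSup_Iio] at h1
  have h2 : sSup c ≤ α := csSup_le' fun ξ hξ => (hcon ξ hξ).le
  exact absurd hα (not_lt.2 (h1 ▸ h2))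

/-- The next step of the walk from `β` to `α` along `C`. -/
noncomputable def nextStep (C : Ordinal.{u} → Set Ordinal.{u}) (α β : Ordinal.{u}) : Ordinal.{u} :=
  sInf (C β ∩ Set.Ici α)

theorem nextStep_mem_Ico {C : Ordinal.{u} → Set Ordinal.{u}} {α β : Ordinal.{u}}
    (h : IsLadder (C β) β) (hαβ : α < β) : α ≤ nextStep C α β ∧ nextStep C α β < β := by
  rcases (C β ∩ Set.Ici α).eq_empty_or_nonempty with he | hne
  · have hlt : ∀ ξ ∈ C β, ξ < α := fun ξ hξ => by
      by_contra hle
      exact Set.eq_empty_iff_forall_notMem.1 he ξ ⟨hξ, not_lt.1 hle⟩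
    have hsup : sSup (C β) ≤ α := csSup_le' fun ξ hξ => (hlt ξ hξ).le
    have hα : sSup (C β) = α := by
      refine le_antisymm hsup ?_
      rw [h.sup_eq]
      exact le_csSup ⟨β, fun _ h => le_of_lt h⟩ hαβ
    -- A positive α would be an accumulation point, hence in C β. For α = 0 the value `sInf ∅ = 0`
    -- is the right next step.
    have hα0 : α = 0 := by
      by_contra hne
      have hCα : C β ∩ Set.Iio α = C β := Set.inter_eq_left.2 hlt
      exact lt_irrefl _ (hlt α (h.closed α hαβ ⟨pos_iff_ne_zero.2 hne, by rw [hCα, hα]⟩))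
    subst hα0
    rw [nextStep, he, Ordinal.sInf_empty]
    exact ⟨le_rfl, hαβ⟩
  · have := csInf_mem hne
    exact ⟨this.2, h.subset this.1⟩

section

variable {V : Type*} [SemilatticeSup V] [OrderBot V]

/-- The supremum of the values of `f` over the steps `τ` of the walk from `β` to `α` along `C`
for which `sup (C τ ∩ α) < α`. The arguments of `f` are `C τ ∩ α` and the next step. -/
noncomputable def walkSup (C : Ordinal.{u} → Set Ordinal.{u})
    (f : Set Ordinal.{u} → Ordinal.{u} → V) (α β : Ordinal.{u}) : V :=
  open Classical in
  if _h : α < β ∧ sSup (C β ∩ Set.Iio α) < α ∧ nextStep C α β < β then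
    f (C β ∩ Set.Iio α) (nextStep C α β) ⊔ walkSup C f α (nextStep C α β)
  else ⊥
termination_by β
decreasing_by exact _h.2.2

variable {C : Ordinal.{u} → Set Ordinal.{u}} {f : Set Ordinal.{u} → Ordinal.{u} → V}
  {α β : Ordinal.{u}}

theorem walkSup_self : walkSup C f α α = ⊥ := by
  rw [walkSup.eq_def, dif_neg (fun h => lt_irrefl _ h.1)]

theorem walkSup_of_not_lt (h : ¬ sSup (C β ∩ Set.Iio α) < α) : walkSup C f α β = ⊥ := by
  rw [walkSup.eq_def, dif_neg (fun h' => h h'.2.1)]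

theorem walkSup_of_lt (hC : IsLadder (C β) β) (hαβ : α < β)
    (h : sSup (C β ∩ Set.Iio α) < α) : walkSup C f α β =
      f (C β ∩ Set.Iio α) (nextStep C α β) ⊔ walkSup C f α (nextStep C α β) := by
  rw [walkSup.eq_def, dif_pos ⟨hαβ, h, (nextStep_mem_Ico hC hαβ).2⟩]

theorem walkSup_induction (P : V → Prop) (hbot : P ⊥) (hsup : ∀ x y, P x → P y → P (x ⊔ y))
    (α β : Ordinal.{u}) (hf : ∀ τ ≤ β, α < τ → nextStep C α τ < τ →
      P (f (C τ ∩ Set.Iio α) (nextStep C α τ))) : P (walkSup C f α β) := by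
  induction β using WellFoundedLT.induction with
  | ind β ih =>
    rw [walkSup.eq_def]
    split_ifs with h
    · exact hsup _ _ (hf β le_rfl h.1 h.2.2)
        (ih _ h.2.2 fun τ hτ => hf τ (hτ.trans h.2.2.le))
    · exact hbot

/-- Walks to ordinals in a final segment of `γ` pass through `γ`. -/
theorem IsCoherentSeq.exists_walkSup_eq {κ : Cardinal.{u}} (hC : IsCoherentSeq κ C)
    (f : Set Ordinal.{u} → Ordinal.{u} → V) {γ : Ordinal.{u}} (hγ : 0 < γ) (β : Ordinal.{u})
    (hβ : β < κ.ord) (hγβ : γ ≤ β) : ∃ ζ < γ, ∀ α, ζ < α → α < γ →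
      walkSup C f α β = walkSup C f γ β ⊔ walkSup C f α γ := by
  induction β using WellFoundedLT.induction with
  | ind β ih =>
    rcases hγβ.eq_or_lt with rfl | hlt
    · exact ⟨0, hγ, fun α _ _ => by rw [walkSup_self, bot_sup_eq]⟩
    have hL := hC.ladder β hβ
    have hLγ := hC.ladder γ (hlt.trans hβ)
    -- If C β ∩ γ is bounded below γ, then C β has the same trace and next step for α near γ as for
    -- γ.
    rcases (sSup_inter_Iio_le (C β) γ).lt_or_eq with hs | hs
    · obtain ⟨h1, h2⟩ := nextStep_mem_Ico hL hlt
      obtain ⟨ζ, hζ, h⟩ := ih _ h2 (h2.trans hβ) h1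
      refine ⟨max ζ (sSup (C β ∩ Set.Iio γ)), max_lt hζ hs, fun α hα hαγ => ?_⟩
      rw [max_lt_iff] at hα
      have hlow : ∀ ξ ∈ C β, ξ < γ → ξ < α := fun ξ h1 h2 =>
        (le_sSup_inter_Iio h1 h2).trans_lt hα.2
      have e1 : C β ∩ Set.Iio α = C β ∩ Set.Iio γ := by
        ext ξ
        exact ⟨fun h => ⟨h.1, lt_trans h.2 hαγ⟩, fun h => ⟨h.1, hlow ξ h.1 h.2⟩⟩
      have e2 : nextStep C α β = nextStep C γ β := by
        unfold nextStep
        congr 1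
        ext ξ
        refine ⟨fun h => ⟨h.1, ?_⟩, fun h => ⟨h.1, hαγ.le.trans h.2⟩⟩
        by_contra hlt
        exact absurd (hlow ξ h.1 (not_le.1 hlt)) (not_lt.2 h.2)
      rw [walkSup_of_lt hL (hαγ.trans hlt) (by rw [e1]; exact hα.2), e1, e2, h α hα.1 hαγ,
        walkSup_of_lt hL hlt hs, sup_assoc]
    -- Here the walk to γ contributes ⊥, and by coherence stepping from β to α is the same as
    -- stepping from γ.
    · have hacc : IsAccPt (C β) γ := ⟨hγ, hs⟩
      have hcoh := hC.coherent β hβ γ ⟨hL.closed γ hlt hacc, hacc⟩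
      refine ⟨0, hγ, fun α _ hαγ => ?_⟩
      rw [walkSup_of_not_lt (α := γ) (by rw [hs]; exact lt_irrefl _), bot_sup_eq]
      have e1 : C β ∩ Set.Iio α = C γ ∩ Set.Iio α := by
        rw [← hcoh, Set.inter_assoc, Set.inter_eq_self_of_subset_right
          (Set.Iio_subset_Iio hαγ.le)]
      have e2 : nextStep C α β = nextStep C α γ := by
        obtain ⟨ξ, h1, h2, h3⟩ := hacc.exists_gt hαγ
        unfold nextStep
        rw [← hcoh]
        refine le_antisymm (csInf_le_csInf (OrderBot.bddBelow _) ⟨ξ, ⟨h1, h3⟩, h2.le⟩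
          fun x hx => ⟨hx.1.1, hx.2⟩) ?_
        have hm := csInf_mem (s := C β ∩ Set.Ici α) ⟨ξ, h1, h2.le⟩
        have hle : sInf (C β ∩ Set.Ici α) ≤ ξ := csInf_le' ⟨h1, h2.le⟩
        exact csInf_le' ⟨⟨hm.1, hle.trans_lt h3⟩, hm.2⟩
      by_cases hsα : sSup (C γ ∩ Set.Iio α) < α
      · rw [walkSup_of_lt hL (hαγ.trans hlt) (by rwa [e1]), walkSup_of_lt hLγ hαγ hsα, e1, e2]
      · rw [walkSup_of_not_lt hsα, walkSup_of_not_lt (by rwa [e1])]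

end

/-! ### The tree of stationary traces -/

/-- The sets that are, for stationarily many `γ`, the trace of `C γ` on `ζ`. -/
def statTraces (κ : Cardinal.{u}) (C : Ordinal.{u} → Set Ordinal.{u}) (ζ : Ordinal.{u}) :
    Set (Set Ordinal.{u}) :=
  {x | StatIn κ {γ | C γ ∩ Set.Iio ζ = x}}

theorem inter_Iio_inter_Iio {c : Set Ordinal.{u}} {ζ ζ' : Ordinal.{u}} (h : ζ' ≤ ζ) :
    c ∩ Set.Iio ζ ∩ Set.Iio ζ' = c ∩ Set.Iio ζ' := by
  rw [Set.inter_assoc, Set.inter_eq_self_of_subset_right (Set.Iio_subset_Iio h)]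

theorem inter_Iio_mem_statTraces {κ : Cardinal.{u}} {C : Ordinal.{u} → Set Ordinal.{u}}
    {ζ ζ' : Ordinal.{u}} {x : Set Ordinal.{u}} (hx : x ∈ statTraces κ C ζ) (h : ζ' ≤ ζ) :
    x ∩ Set.Iio ζ' ∈ statTraces κ C ζ' :=
  StatIn.mono hx fun γ hγ => by
    rw [Set.mem_ofPred_eq] at hγ ⊢
    rw [← hγ, inter_Iio_inter_Iio h]

theorem subset_Iio_of_mem_statTraces {κ : Cardinal.{u}} (hκ : κ.IsRegular)
    {C : Ordinal.{u} → Set Ordinal.{u}} {ζ : Ordinal.{u}} {x : Set Ordinal.{u}}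
    (hx : x ∈ statTraces κ C ζ) : x ⊆ Set.Iio ζ := by
  obtain ⟨γ, hγ, -⟩ := StatIn.exists_gt hx hκ hκ.ord_pos
  rw [← hγ]
  exact Set.inter_subset_right

/-- There are fewer than θ pairs of distinct traces, each pair differs at a point below ζ, and
cofinality θ bounds these points. -/
theorem exists_statTraces_injOn {κ θ : Cardinal.{u}} (hκ : κ.IsRegular) (hθ : θ.IsRegular)
    {C : Ordinal.{u} → Set Ordinal.{u}}
    (hT : ∀ ζ < κ.ord, Cardinal.mk (statTraces κ C ζ) < Cardinal.lift.{u + 1} θ)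
    {ζ : Ordinal.{u}} (hζ : ζ < κ.ord) (hcof : ζ.cof = θ) :
    ∃ b < ζ, Set.InjOn (· ∩ Set.Iio b) (statTraces κ C ζ) := by
  have hlim : Order.IsSuccLimit ζ := Ordinal.one_lt_cof_iff.1
    (hcof ▸ Cardinal.one_lt_aleph0.trans_le hθ.aleph0_le)
  have h1 : ∀ p : statTraces κ C ζ × statTraces κ C ζ, ∃ d < ζ,
      p.1 ≠ p.2 → ¬ (d ∈ p.1.1 ↔ d ∈ p.2.1) := by
    rintro ⟨⟨x, hx⟩, ⟨y, hy⟩⟩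
    by_cases hne : x = y
    · exact ⟨0, hlim.bot_lt, fun h => absurd (Subtype.ext hne) h⟩
    · have : ∃ d, ¬ (d ∈ x ↔ d ∈ y) := by
        by_contra! hcon
        exact hne (Set.ext hcon)
      obtain ⟨d, hd⟩ := this
      refine ⟨d, ?_, fun _ => hd⟩
      have hxs := subset_Iio_of_mem_statTraces hκ hx
      have hys := subset_Iio_of_mem_statTraces hκ hy
      by_contra hlt
      exact hd ⟨fun h => absurd (hxs h) hlt, fun h => absurd (hys h) hlt⟩
  choose d hd hd' using h1
  have hθ' : (Cardinal.lift.{u + 1} θ).IsRegular := hθ.lift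
  obtain ⟨b, hb, h⟩ := exists_lt_forall_le_of_lt_cof d (by
    rw [Cardinal.mk_prod, Cardinal.lift_id, hcof]
    exact Cardinal.mul_lt_of_lt hθ'.aleph0_le (hT ζ hζ) (hT ζ hζ)) hd
  refine ⟨Order.succ b, hlim.succ_lt hb, fun x hx y hy hxy => ?_⟩
  by_contra hne
  refine hd' ⟨⟨x, hx⟩, ⟨y, hy⟩⟩ (fun h => hne (congrArg Subtype.val h)) ?_
  have hm := Order.lt_succ_of_le (h ⟨⟨x, hx⟩, ⟨y, hy⟩⟩)
  have := Set.ext_iff.1 hxy (d ⟨⟨x, hx⟩, ⟨y, hy⟩⟩)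
  exact ⟨fun h => (this.1 ⟨h, hm⟩).1, fun h => (this.2 ⟨h, hm⟩).1⟩

namespace IsCoherentSeq

variable {κ : Cardinal.{u}} {C : Ordinal.{u} → Set Ordinal.{u}}

/-- Take η = sup(C γ ∩ ζ): if η < ζ, at most the point η is added to the trace on η; if η = ζ,
coherence applies. This drives the induction that counts traces. -/
theorem inter_Iio_cases (hC : IsCoherentSeq κ C) {γ ζ : Ordinal.{u}} (hγ : γ < κ.ord)
    (hζ : ζ < κ.ord) : C γ ∩ Set.Iio ζ = C ζ ∨ ∃ η < ζ, C γ ∩ Set.Iio ζ = C γ ∩ Set.Iio η ∨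
      C γ ∩ Set.Iio ζ = insert η (C γ ∩ Set.Iio η) := by
  rcases (sSup_inter_Iio_le (C γ) ζ).lt_or_eq with hs | hs
  · refine Or.inr ⟨_, hs, ?_⟩
    set η := sSup (C γ ∩ Set.Iio ζ)
    have hle : ∀ ξ ∈ C γ, ξ < ζ → ξ ≤ η := fun ξ h1 h2 => le_sSup_inter_Iio h1 h2
    by_cases hη : η ∈ C γ
    · refine Or.inr (Set.ext fun ξ => ⟨fun h => ?_, ?_⟩)
      · rcases (hle ξ h.1 h.2).eq_or_lt with h' | h'
        · exact Or.inl h'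
        · exact Or.inr ⟨h.1, h'⟩
      · rintro (rfl | h)
        · exact ⟨hη, hs⟩
        · exact ⟨h.1, lt_trans h.2 hs⟩
    · refine Or.inl (Set.ext fun ξ => ⟨fun h => ⟨h.1, lt_of_le_of_ne (hle ξ h.1 h.2) ?_⟩,
        fun h => ⟨h.1, lt_trans h.2 hs⟩⟩)
      rintro rfl
      exact hη h.1
  · left
    rcases eq_or_ne ζ 0 with rfl | h0
    · rw [Set.eq_empty_of_subset_empty (s := C 0) fun ξ hξ =>
        absurd (Set.mem_Iio.1 ((hC.ladder 0 hζ).subset hξ)) not_lt_zero]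
      exact Set.eq_empty_of_subset_empty fun ξ hξ => absurd (Set.mem_Iio.1 hξ.2) not_lt_zero
    have hacc : IsAccPt (C γ) ζ := ⟨pos_iff_ne_zero.2 h0, hs⟩
    have hL := hC.ladder γ hγ
    rcases lt_trichotomy ζ γ with h | rfl | h
    · exact hC.coherent γ hγ ζ ⟨hL.closed ζ h hacc, hacc⟩
    · exact Set.inter_eq_left.2 hL.subset
    · obtain ⟨ξ, h1, h2, -⟩ := hacc.exists_gt h
      exact absurd (hL.subset h1) (not_lt.2 h2.le)

theorem mk_traces_lt (hC : IsCoherentSeq κ C) (hκ : κ.IsRegular) (ζ : Ordinal.{u})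
    (hζ : ζ < κ.ord) : Cardinal.mk ((fun γ => C γ ∩ Set.Iio ζ) '' Set.Iio κ.ord) <
      Cardinal.lift.{u + 1} κ := by
  have hκ' : (Cardinal.lift.{u + 1} κ).IsRegular := hκ.lift
  induction ζ using WellFoundedLT.induction with
  | ind ζ ih =>
    set P : Ordinal.{u} → Set (Set Ordinal.{u}) :=
      fun ζ => (fun γ => C γ ∩ Set.Iio ζ) '' Set.Iio κ.ord with hP
    have hsub : P ζ ⊆ {C ζ} ∪ ⋃ η : Set.Iio ζ, (P η ∪ insert (η : Ordinal.{u}) '' P η) := by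
      rintro _ ⟨γ, hγ, rfl⟩
      rcases hC.inter_Iio_cases hγ hζ with h | ⟨η, hη, h | h⟩
      · exact Or.inl h
      · exact Or.inr (Set.mem_iUnion.2 ⟨⟨η, hη⟩, Or.inl ⟨γ, hγ, h.symm⟩⟩)
      · exact Or.inr (Set.mem_iUnion.2 ⟨⟨η, hη⟩, Or.inr ⟨_, ⟨γ, hγ, rfl⟩, h.symm⟩⟩)
    refine (Cardinal.mk_le_mk_of_subset hsub).trans_lt ((Cardinal.mk_union_le _ _).trans_lt
      (Cardinal.add_lt_of_lt hκ'.aleph0_le ?_ ?_))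
    · rw [Cardinal.mk_singleton]
      exact Cardinal.one_lt_aleph0.trans_le hκ'.aleph0_le
    · rw [Cardinal.card_iUnion_lt_iff_forall_of_isRegular hκ' (mk_Iio_lt_lift hζ)]
      intro η
      have := ih η η.2 (lt_trans η.2 hζ)
      exact (Cardinal.mk_union_le _ _).trans_lt (Cardinal.add_lt_of_lt hκ'.aleph0_le this
        (Cardinal.mk_image_le.trans_lt this))

theorem exists_statIn_trace (hC : IsCoherentSeq κ C) (hκ : κ.IsRegular) {E : Set Ordinal.{u}}
    (hE : StatIn κ E) {ζ : Ordinal.{u}} (hζ : ζ < κ.ord) :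
    ∃ x, StatIn κ {γ ∈ E | C γ ∩ Set.Iio ζ = x} :=
  let ⟨x, _, hx⟩ := hE.exists_fiber hκ (fun γ => C γ ∩ Set.Iio ζ) _ (hC.mk_traces_lt hκ ζ hζ)
    fun γ _ hγ => ⟨γ, hγ, rfl⟩
  ⟨x, hx⟩

/-- If the tree of stationary traces is narrow, then there is a thread. -/
theorem exists_club_of_mk_statTraces_lt (hC : IsCoherentSeq κ C) (hκ : κ.IsRegular)
    {θ : Cardinal.{u}} (hθ : θ.IsRegular) (hθκ : θ < κ)
    (hT : ∀ ζ < κ.ord, Cardinal.mk (statTraces κ C ζ) < Cardinal.lift.{u + 1} θ) :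
    ∃ D : Set Ordinal.{u}, IsClubIn D κ ∧ ∀ α ∈ accPts D, D ∩ Set.Iio α = C α := by
  have hinj : ∀ ζ, ∃ b, ζ < κ.ord → ζ.cof = θ →
      b < ζ ∧ Set.InjOn (· ∩ Set.Iio b) (statTraces κ C ζ) := fun ζ => by
    by_cases h : ζ < κ.ord ∧ ζ.cof = θ
    · obtain ⟨b, hb⟩ := exists_statTraces_injOn hκ hθ hT h.1 h.2
      exact ⟨b, fun _ _ => hb⟩
    · exact ⟨0, fun h1 h2 => absurd ⟨h1, h2⟩ h⟩
  choose g hg using hinj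
  obtain ⟨ζ₀, hζ₀, hR'⟩ := (statIn_cof_eq hκ hθ hθκ).exists_bounded_of_regressive hκ g
    fun γ h1 h2 _ => (hg γ h2 h1).1
  have hR := hR'.inter_Ioo hκ hζ₀
  set R := {γ ∈ {γ ∈ {γ : Ordinal.{u} | γ.cof = θ} | g γ ≤ ζ₀} |
    ζ₀ < γ ∧ γ < κ.ord ∧ Order.IsSuccLimit γ} with hRdef
  have hRinj : ∀ ζ ∈ R, ∀ x ∈ statTraces κ C ζ, ∀ y ∈ statTraces κ C ζ,
      x ∩ Set.Iio ζ₀ = y ∩ Set.Iio ζ₀ → x = y := by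
    rintro ζ ⟨⟨h1, h2⟩, -, h3, -⟩ x hx y hy hxy
    refine (hg ζ h3 h1).2 hx hy ?_
    change x ∩ _ = y ∩ _
    rw [← inter_Iio_inter_Iio (c := x) h2, hxy, inter_Iio_inter_Iio h2]
  have hRgt : ∀ ζ ∈ R, ζ₀ < ζ ∧ ζ < κ.ord := fun ζ h => ⟨h.2.1, h.2.2.1⟩
  have hRex : ∀ η < κ.ord, ∃ ζ ∈ R, η < ζ := fun η hη =>
    let ⟨ζ, h1, _, h2, _⟩ := hR.exists_gt hκ hη
    ⟨ζ, h1, h2⟩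
  obtain ⟨x₀, hx₀⟩ := hC.exists_statIn_trace hκ hR hζ₀
  set D : Set Ordinal.{u} :=
    {ξ | ∃ ζ ∈ R, ∃ y ∈ statTraces κ C ζ, y ∩ Set.Iio ζ₀ = x₀ ∧ ξ ∈ y} with hD
  -- Among traces extending x₀, each level in R has at most one, so they cohere and D is their
  -- union.
  have hDeq : ∀ ζ ∈ R, ∀ y ∈ statTraces κ C ζ, y ∩ Set.Iio ζ₀ = x₀ → D ∩ Set.Iio ζ = y := by
    intro ζ hζ y hy hy₀
    have hys := subset_Iio_of_mem_statTraces hκ hy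
    refine Set.ext fun ξ => ⟨?_, fun h => ⟨⟨ζ, hζ, y, hy, hy₀, h⟩, hys h⟩⟩
    rintro ⟨⟨ζ', hζ', y', hy', hy₀', hξ⟩, hξζ⟩
    rcases le_total ζ ζ' with h | h
    · have := hRinj ζ hζ _ (inter_Iio_mem_statTraces hy' h) y hy (by
        rw [inter_Iio_inter_Iio (hRgt ζ hζ).1.le, hy₀, hy₀'])
      rw [← this]
      exact ⟨hξ, hξζ⟩
    · have := hRinj ζ' hζ' _ (inter_Iio_mem_statTraces hy h) y' hy' (by
        rw [inter_Iio_inter_Iio (hRgt ζ' hζ').1.le, hy₀, hy₀'])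
      rw [← this] at hξ
      exact hξ.1
  have hext : ∀ E, StatIn κ E → (∀ γ ∈ E, C γ ∩ Set.Iio ζ₀ = x₀) → ∀ ζ ∈ R,
      ∃ γ ∈ E, C γ ∩ Set.Iio ζ = D ∩ Set.Iio ζ ∧ D ∩ Set.Iio ζ ∈ statTraces κ C ζ ∧ ζ < γ ∧
        γ < κ.ord := by
    intro E hE hE₀ ζ hζ
    obtain ⟨y, hy⟩ := hC.exists_statIn_trace hκ hE (hRgt ζ hζ).2
    obtain ⟨γ, ⟨hγE, hγ⟩, hγκ, hζγ, -⟩ := hy.exists_gt hκ (hRgt ζ hζ).2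
    have hyT : y ∈ statTraces κ C ζ := hy.mono fun _ h => h.2
    have := hDeq ζ hζ y hyT (by
      rw [← hγ, inter_Iio_inter_Iio (hRgt ζ hζ).1.le, hE₀ γ hγE])
    exact ⟨γ, hγE, by rw [this, hγ], by rwa [this], hζγ, hγκ⟩
  have hDκ : D ⊆ Set.Iio κ.ord := by
    rintro ξ ⟨ζ, hζ, y, hy, -, hξ⟩
    exact lt_trans (subset_Iio_of_mem_statTraces hκ hy hξ) (hRgt ζ hζ).2
  have hacc : ∀ δ < κ.ord, IsAccPt D δ → δ ∈ D ∧ D ∩ Set.Iio δ = C δ := by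
    intro δ hδ hDδ
    obtain ⟨ζ, hζ, hδζ⟩ := hRex δ hδ
    obtain ⟨γ, -, hγ, -, hζγ, hγκ⟩ := hext _ hx₀ (fun _ h => h.2) ζ hζ
    have he : C γ ∩ Set.Iio δ = D ∩ Set.Iio δ := by
      rw [← inter_Iio_inter_Iio hδζ.le, hγ, inter_Iio_inter_Iio hδζ.le]
    have ha : IsAccPt (C γ) δ := ⟨hDδ.1, by rw [he, hDδ.2]⟩
    have hm := (hC.ladder γ hγκ).closed δ (hδζ.trans hζγ) ha
    have hm' : δ ∈ C γ ∩ Set.Iio ζ := ⟨hm, hδζ⟩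
    rw [hγ] at hm'
    exact ⟨hm'.1, he ▸ hC.coherent γ hγκ δ ⟨hm, ha⟩⟩
  refine ⟨D, ⟨hDκ, fun δ hδ h => (hacc δ hδ h).1, fun α hα => ?_⟩,
    fun α hα => (hacc α (hDκ hα.1) hα.2).2⟩
  -- If D were bounded by α < ζ₁, press down on min(C γ \ ζ₁) over the γ with C γ ∩ ζ₁ = D ∩ ζ₁. At
  -- a level ζ₂ above the bound this minimum enters D.
  by_contra! hcon
  obtain ⟨ζ₁, hζ₁, hαζ₁⟩ := hRex α hα
  obtain ⟨-, -, -, hD₁, -⟩ := hext _ hx₀ (fun _ h => h.2) ζ₁ hζ₁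
  have hG := StatIn.inter_Ioo hD₁ hκ (hRgt ζ₁ hζ₁).2
  have hm : ∀ γ ∈ {γ ∈ {γ | C γ ∩ Set.Iio ζ₁ = D ∩ Set.Iio ζ₁} |
      ζ₁ < γ ∧ γ < κ.ord ∧ Order.IsSuccLimit γ}, γ < κ.ord →
      sInf (C γ ∩ Set.Ici ζ₁) ∈ C γ ∩ Set.Ici ζ₁ := by
    rintro γ ⟨-, h1, h2, h3⟩ -
    obtain ⟨ξ, hξ, hξ'⟩ := (hC.ladder γ h2).exists_ge h3 h1
    exact csInf_mem ⟨ξ, hξ, hξ'⟩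
  obtain ⟨b, hb, hG'⟩ := hG.exists_bounded_of_regressive hκ (fun γ => sInf (C γ ∩ Set.Ici ζ₁))
    fun γ h1 h2 _ => (hC.ladder γ h2).subset (hm γ h1 h2).1
  obtain ⟨ζ₂, hζ₂, hlt⟩ := hRex (max b ζ₁) (max_lt hb (hRgt ζ₁ hζ₁).2)
  rw [max_lt_iff] at hlt
  obtain ⟨γ, ⟨hγG, hγb⟩, hγ, -, -, hγκ⟩ := hext _ hG' (fun γ h => by
    have := (hRgt ζ₁ hζ₁).1.le
    rw [← inter_Iio_inter_Iio this, h.1.1, inter_Iio_inter_Iio this]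
    obtain ⟨ν, ⟨-, hν₀⟩, hν, -⟩ := hext _ hx₀ (fun _ h => h.2) ζ₁ hζ₁
    rw [← inter_Iio_inter_Iio this, ← hν, inter_Iio_inter_Iio this, hν₀]) ζ₂ hζ₂
  obtain ⟨hm1, hm2⟩ := hm γ hγG hγκ
  have hmD : sInf (C γ ∩ Set.Ici ζ₁) ∈ C γ ∩ Set.Iio ζ₂ := ⟨hm1, lt_of_le_of_lt hγb hlt.1⟩
  rw [hγ] at hmD
  exact absurd (hcon _ hmD.1) (not_lt.2 (hαζ₁.le.trans hm2))

/-- A coherent sequence without a thread carries `θ` many stationary classes. -/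
theorem exists_index (hC : IsCoherentSeq κ C) (hκ : κ.IsRegular)
    (hnt : ¬ ∃ D : Set Ordinal.{u}, IsClubIn D κ ∧ ∀ α ∈ accPts D, D ∩ Set.Iio α = C α)
    {θ : Cardinal.{u}} (hθ : θ.IsRegular) (hθκ : θ < κ) :
    ∃ ζ < κ.ord, ∃ idx : Set Ordinal.{u} → Ordinal.{u}, (∀ x, idx x < θ.ord) ∧
      (∀ x η, ζ ≤ η → idx (x ∩ Set.Iio η) = idx x) ∧
      ∀ i < θ.ord, StatIn κ {γ | idx (C γ) = i} := by
  have h1 : ∃ ζ < κ.ord, Cardinal.lift.{u + 1} θ ≤ Cardinal.mk (statTraces κ C ζ) := by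
    by_contra! hcon
    exact hnt (hC.exists_club_of_mk_statTraces_lt hκ hθ hθκ hcon)
  obtain ⟨ζ, hζ, hle⟩ := h1
  rw [← mk_Iio_ord, Cardinal.le_def] at hle
  obtain ⟨e⟩ := hle
  classical
  refine ⟨ζ, hζ, fun x => if h : ∃ i, (e i : Set Ordinal.{u}) = x ∩ Set.Iio ζ then h.choose else 0,
    fun x => ?_, fun x η hη => ?_, fun i hi => ?_⟩
  · dsimp only
    split_ifs with h
    · exact h.choose.2
    · exact hθ.ord_pos
  · simp only [inter_Iio_inter_Iio hη]
  · refine StatIn.mono (e ⟨i, hi⟩).2 fun γ hγ => ?_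
    rw [Set.mem_ofPred_eq] at hγ ⊢
    have h : ∃ j, (e j : Set Ordinal.{u}) = C γ ∩ Set.Iio ζ := ⟨⟨i, hi⟩, hγ.symm⟩
    dsimp only
    rw [dif_pos h]
    exact congrArg Subtype.val (e.injective (Subtype.ext (h.choose_spec.trans hγ)))

end IsCoherentSeq

/-! ### Disjoint families and cofinality -/

namespace IsDisjointFamily

variable {κ χ : Cardinal.{u}} {σ : Ordinal.{u}} {𝒜 : Set (Set Ordinal.{u})}

theorem mk_eq (h : IsDisjointFamily κ σ 𝒜) {a : Set Ordinal.{u}} (ha : a ∈ 𝒜) :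
    Cardinal.mk a = Cardinal.lift.{u + 1} σ.card := by
  have := congrArg Ordinal.card (h.otp_eq a ha)
  rwa [Ordinal.card_type, ← Ordinal.lift_card] at this

theorem mk_lt (h : IsDisjointFamily κ σ 𝒜) (hσ : σ < χ.ord) {a : Set Ordinal.{u}} (ha : a ∈ 𝒜) :
    Cardinal.mk a < Cardinal.lift.{u + 1} χ := by
  rw [h.mk_eq ha, Cardinal.lift_lt]
  exact Cardinal.lt_ord.1 hσ

/-- A family containing ∅ has σ = 0, so it is {∅}, of size 1 < κ. -/
theorem nonempty (h : IsDisjointFamily κ σ 𝒜) (hκ : κ.IsRegular) {a : Set Ordinal.{u}}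
    (ha : a ∈ 𝒜) : a.Nonempty := by
  by_contra hne
  rw [Set.not_nonempty_iff_eq_empty] at hne
  have h0 := h.mk_eq ha
  rw [hne, Cardinal.mk_eq_zero] at h0
  have hsub : 𝒜 ⊆ {∅} := fun b hb => by
    have := h.mk_eq hb
    rw [← h0, Cardinal.mk_set_eq_zero_iff] at this
    exact this
  have h1 := Cardinal.mk_le_mk_of_subset hsub
  rw [h.card_eq, Cardinal.mk_singleton] at h1
  exact absurd (Cardinal.one_lt_aleph0.trans_le hκ.lift.aleph0_le) (not_lt.2 h1)

theorem exists_gt (h : IsDisjointFamily κ σ 𝒜) (hκ : κ.IsRegular) {η : Ordinal.{u}}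
    (hη : η < κ.ord) : ∃ a ∈ 𝒜, ∀ α ∈ a, η < α := by
  by_contra! hcon
  choose! p hp hp' using hcon
  have hinj : Function.Injective fun a : 𝒜 => (⟨p a, hp' a a.2⟩ : Set.Iic η) := by
    intro a b hab
    by_contra hne
    have := h.disjoint a.2 b.2 (fun h => hne (Subtype.ext h))
    have hpab : p a = p b := congrArg Subtype.val hab
    exact Set.disjoint_left.1 this (hp a a.2) (hpab ▸ hp b b.2)
  have := Cardinal.mk_le_of_injective hinj
  rw [h.card_eq] at this
  exact absurd (mk_Iic_lt_lift hκ hη) (not_lt.2 this)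

end IsDisjointFamily

/-- A function from a limit ordinal of cofinality other than `θ` to `θ` is bounded on a cofinal
set. -/
theorem exists_lt_ord_forall_exists_le {θ : Cardinal.{u}} (hθ : θ.IsRegular) {γ : Ordinal.{u}}
    (hγ : γ.cof ≠ θ) (p : Ordinal.{u} → Ordinal.{u}) (hp : ∀ ζ < γ, p ζ < θ.ord) :
    ∃ e < θ.ord, ∀ ζ < γ, ∃ ζ' < γ, ζ ≤ ζ' ∧ p ζ' ≤ e := by
  rcases hγ.lt_or_gt with hlt | hlt
  -- If cof γ < θ, the values on a cofinal set of size cof γ are bounded in θ.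
  · obtain ⟨s, hs, hs'⟩ := Order.exists_cof_eq (Set.Iio γ)
    rw [Ordinal.cof_Iio, ← Ordinal.lift_cof] at hs'
    obtain ⟨e, he, h⟩ := exists_lt_ord_forall_le hθ (fun i : s => p i)
      (by rwa [hs', Cardinal.lift_lt]) (fun i => hp i i.1.2)
    refine ⟨e, he, fun ζ hζ => ?_⟩
    obtain ⟨ζ', h1, h2⟩ := hs ⟨ζ, hζ⟩
    exact ⟨ζ', ζ'.2, h2, h ⟨ζ', h1⟩⟩
  -- If cof γ > θ, the failures z e for e < θ have a common bound b < γ, refuted by e = p b.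
  · by_contra! hcon
    choose! z hz hz' using hcon
    obtain ⟨b, hb, h⟩ := exists_lt_forall_le_of_lt_cof (fun e : Set.Iio θ.ord => z e)
      (by rwa [mk_Iio_ord, Cardinal.lift_lt]) (fun e => hz e e.2)
    exact lt_irrefl _ (hz' (p b) (hp b hb) b hb (h ⟨p b, hp b hb⟩))

theorem exists_isRegular_lt_ne {κ : Cardinal.{u}} (hκ : Cardinal.aleph 1 < κ) (θ : Cardinal.{u}) :
    ∃ μ : Cardinal.{u}, μ.IsRegular ∧ μ < κ ∧ μ ≠ θ := by
  by_cases h : θ = Cardinal.aleph0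
  · exact ⟨_, Cardinal.isRegular_aleph_one, hκ, h ▸ Cardinal.aleph0_lt_aleph_one.ne'⟩
  · exact ⟨_, Cardinal.isRegular_aleph0, Cardinal.aleph0_lt_aleph_one.trans hκ, Ne.symm h⟩

/-! ### The colouring and its constant rectangles -/

/-- The largest pair of an index and a next step along the walk from `β` to `α`, in the
lexicographic order. -/
noncomputable def walkMax (C : Ordinal.{u} → Set Ordinal.{u}) (idx : Set Ordinal.{u} → Ordinal.{u})
    (α β : Ordinal.{u}) : Ordinal.{u} ×ₗ Ordinal.{u} :=
  walkSup C (fun x n => toLex (idx x, n)) α β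

section

variable {C : Ordinal.{u} → Set Ordinal.{u}} {idx : Set Ordinal.{u} → Ordinal.{u}}
  {α β o : Ordinal.{u}} {κ : Cardinal.{u}}

theorem sup_of_linearOrder {V : Type*} [LinearOrder V] (P : V → Prop) (x y : V) (hx : P x) (hy : P y) :
    P (x ⊔ y) := by
  rcases le_total x y with h | h
  · rwa [sup_eq_right.2 h]
  · rwa [sup_eq_left.2 h]

theorem walkMax_fst_lt (ho : 0 < o) (h : ∀ x, idx x < o) : (ofLex (walkMax C idx α β)).1 < o :=
  walkSup_induction (fun v : Ordinal.{u} ×ₗ Ordinal.{u} => (ofLex v).1 < o) ho (sup_of_linearOrder _) α β fun _ _ _ _ => h _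

theorem walkMax_snd_lt (ho : 0 < o) (hβ : β < o) : (ofLex (walkMax C idx α β)).2 < o :=
  walkSup_induction (fun v : Ordinal.{u} ×ₗ Ordinal.{u} => (ofLex v).2 < o) ho (sup_of_linearOrder _) α β
    fun _ h1 _ h2 => (h2.trans_le h1).trans hβ

/-- Every next step is at least α; positivity of the index excludes the default ⊥ = (0, 0). -/
theorem le_walkMax_snd (hC : IsCoherentSeq κ C) (hβ : β < κ.ord)
    (h : 0 < (ofLex (walkMax C idx α β)).1) : α ≤ (ofLex (walkMax C idx α β)).2 :=
  walkSup_induction (fun v : Ordinal.{u} ×ₗ Ordinal.{u} => 0 < (ofLex v).1 → α ≤ (ofLex v).2)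
    (fun h => absurd h (lt_irrefl 0)) (sup_of_linearOrder _) α β
    (fun τ h1 h2 _ _ => (nextStep_mem_Ico (hC.ladder τ (h1.trans_lt hβ)) h2).1) h

end

theorem le_of_fst_lt {x y : Ordinal.{u} ×ₗ Ordinal.{u}} (h : (ofLex x).1 < (ofLex y).1) : x ≤ y :=
  Prod.Lex.le_iff.2 (Or.inl h)

namespace IsCoherentSeq

variable {κ χ θ : Cardinal.{u}} {C : Ordinal.{u} → Set Ordinal.{u}}
  {idx : Set Ordinal.{u} → Ordinal.{u}} {σ : Ordinal.{u}} {𝒜 : Set (Set Ordinal.{u})}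

/-- Unboundedly many `δ` lie below a member of the family from which all walks to ordinals in
`(Λ, δ)` pass through `δ`, with a bound on `walkMax` that does not depend on `δ`. -/
theorem exists_uniform_walkMax_above (hC : IsCoherentSeq κ C) (hχ : χ.IsRegular) (hθ : θ.IsRegular)
    (hκ : κ.IsRegular) (hχθ : χ ≤ θ) (hχκ : χ < κ) (hθκ : θ < κ) (hidx : ∀ x, idx x < θ.ord)
    (hσ : σ < χ.ord) (h𝒜 : IsDisjointFamily κ σ 𝒜) :
    ∃ Λ < κ.ord, ∃ e < θ.ord, ∀ η < κ.ord, ∃ δ < κ.ord, η < δ ∧ ∃ b ∈ 𝒜, ∀ β ∈ b, δ < β ∧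
      (ofLex (walkMax C idx δ β)).1 ≤ e ∧ ∀ α, Λ < α → α < δ →
        walkMax C idx α β = walkMax C idx δ β ⊔ walkMax C idx α δ := by
  have h1 : ∀ δ, ∃ Λ e b, δ < κ.ord → δ.cof = χ → Λ < δ ∧ e < θ.ord ∧ b ∈ 𝒜 ∧ ∀ β ∈ b, δ < β ∧
      (ofLex (walkMax C idx δ β)).1 ≤ e ∧ ∀ α, Λ < α → α < δ →
        walkMax C idx α β = walkMax C idx δ β ⊔ walkMax C idx α δ := fun δ => by
    by_cases hδ : δ < κ.ord ∧ δ.cof = χ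
    · have h0 : 0 < δ := Ordinal.cof_pos.1 (hδ.2 ▸ hχ.pos)
      obtain ⟨b, hb, hδb⟩ := h𝒜.exists_gt hκ hδ.1
      have hbm := h𝒜.mk_lt hσ hb
      have h2 : ∀ β : b, ∃ ζ < δ, ∀ α, ζ < α → α < δ →
          walkMax C idx α β = walkMax C idx δ β ⊔ walkMax C idx α δ := fun β =>
        hC.exists_walkSup_eq _ h0 β (h𝒜.subset b hb β.2) (hδb β β.2).le
      choose z hz hz' using h2
      -- Since |b| < χ = cof δ, one threshold serves all β ∈ b; Fodor's lemma then removes its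
      -- dependence on δ.
      obtain ⟨Λ, hΛ, hΛ'⟩ := exists_lt_forall_le_of_lt_cof z (by rwa [hδ.2]) hz
      obtain ⟨e, he, he'⟩ := exists_lt_ord_forall_le hθ
        (fun β : b => (ofLex (walkMax C idx δ β)).1)
        (hbm.trans_le (Cardinal.lift_le.2 hχθ)) (fun β => walkMax_fst_lt hθ.ord_pos hidx)
      exact ⟨Λ, e, b, fun _ _ => ⟨hΛ, he, hb, fun β hβ => ⟨hδb β hβ, he' ⟨β, hβ⟩,
        fun α h1 h2 => hz' ⟨β, hβ⟩ α ((hΛ' _).trans_lt h1) h2⟩⟩⟩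
    · exact ⟨0, 0, ∅, fun h1 h2 => absurd ⟨h1, h2⟩ hδ⟩
  choose g e b h using h1
  obtain ⟨Λ, hΛ, hE⟩ := (statIn_cof_eq hκ hχ hχκ).exists_bounded_of_regressive hκ g
    fun γ h1 h2 _ => (h γ h2 h1).1
  obtain ⟨e₀, he₀, hE'⟩ := hE.exists_fiber hκ e (Set.Iio θ.ord)
    (mk_Iio_lt_lift (Cardinal.ord_lt_ord.2 hθκ)) (fun γ h1 h2 => (h γ h2 h1.1).2.1)
  refine ⟨Λ, hΛ, e₀, he₀, fun η hη => ?_⟩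
  obtain ⟨δ, ⟨⟨h1, h2⟩, h3⟩, hδ, hηδ, -⟩ := hE'.exists_gt hκ hη
  obtain ⟨-, -, hb, hall⟩ := h δ hδ h1
  exact ⟨δ, hδ, hηδ, b δ, hb, fun β hβ => ⟨(hall β hβ).1, (hall β hβ).2.1.trans h3.le,
    fun α hα => (hall β hβ).2.2 α (lt_of_le_of_lt h2 hα)⟩⟩

/-- Unboundedly many `γ` are limits of members of the family on which `walkMax` to `γ` has a bound
that does not depend on `γ`. -/
theorem exists_walkMax_le_below (hχθ : χ ≤ θ) (hθ : θ.IsRegular)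
    (hκ : κ.IsRegular) (hκ₁ : Cardinal.aleph 1 < κ) (hθκ : θ < κ) (hidx : ∀ x, idx x < θ.ord)
    (hσ : σ < χ.ord) (h𝒜 : IsDisjointFamily κ σ 𝒜) :
    ∃ e < θ.ord, ∀ η < κ.ord, ∃ γ < κ.ord, η < γ ∧ idx (C γ) ≤ e ∧ ∀ ζ < γ, ∃ a ∈ 𝒜,
      ∀ α ∈ a, ζ < α ∧ α < γ ∧ (ofLex (walkMax C idx α γ)).1 ≤ e := by
  -- Cofinality μ ≠ θ lets indices in θ be bounded along cofinally many members; ℵ₁ < κ provides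
  -- such a μ, either ℵ₀ or ℵ₁.
  obtain ⟨μ, hμ, hμκ, hμθ⟩ := exists_isRegular_lt_ne hκ₁ θ
  have h1 : ∀ ζ, ∃ a F, ζ < κ.ord → F < κ.ord ∧ a ∈ 𝒜 ∧ ∀ α ∈ a, ζ < α ∧ α ≤ F := fun ζ => by
    by_cases hζ : ζ < κ.ord
    · obtain ⟨a, ha, h⟩ := h𝒜.exists_gt hκ hζ
      obtain ⟨F, hF, hF'⟩ := exists_lt_ord_forall_le hκ (fun α : a => (α : Ordinal.{u}))
        ((h𝒜.mk_lt hσ ha).trans_le (Cardinal.lift_le.2 (hχθ.trans hθκ.le)))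
        (fun α => h𝒜.subset a ha α.2)
      exact ⟨a, F, fun _ => ⟨hF, ha, fun α hα => ⟨h α hα, hF' ⟨α, hα⟩⟩⟩⟩
    · exact ⟨∅, 0, fun h => absurd h hζ⟩
  choose a F haF using h1
  by_contra! hcon
  choose! z hz hz' using hcon
  obtain ⟨η, hη, hzη⟩ := exists_lt_ord_forall_le hκ (fun e : Set.Iio θ.ord => z e)
    (by rwa [mk_Iio_ord, Cardinal.lift_lt]) (fun e => hz e e.2)
  obtain ⟨γ, hγμ, hγ, hηγ, -, hcl⟩ := (statIn_cof_eq hκ hμ hμκ).exists_closed_gt hκ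
    (fun ζ hζ => (haF ζ hζ).1) hη
  have h2 : ∀ ζ, ∃ p, ζ < γ → p < θ.ord ∧ ∀ α ∈ a ζ, (ofLex (walkMax C idx α γ)).1 ≤ p :=
    fun ζ => by
    by_cases hζ : ζ < γ
    · obtain ⟨p, hp, hp'⟩ := exists_lt_ord_forall_le hθ
        (fun α : a ζ => (ofLex (walkMax C idx α γ)).1)
        ((h𝒜.mk_lt hσ (haF ζ (hζ.trans hγ)).2.1).trans_le (Cardinal.lift_le.2 hχθ))
        (fun α => walkMax_fst_lt hθ.ord_pos hidx)
      exact ⟨p, fun _ => ⟨hp, fun α hα => hp' ⟨α, hα⟩⟩⟩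
    · exact ⟨0, fun h => absurd h hζ⟩
  choose p hp using h2
  obtain ⟨e, he, hpe⟩ := exists_lt_ord_forall_exists_le hθ (hγμ.trans_ne hμθ) p
    (fun ζ hζ => (hp ζ hζ).1)
  have hm : max e (idx (C γ)) < θ.ord := max_lt he (hidx _)
  obtain ⟨ζ, hζ, hbad⟩ := hz' _ hm γ hγ ((hzη ⟨_, hm⟩).trans_lt hηγ) (le_max_right _ _)
  obtain ⟨ζ', hζ', hle, hpζ⟩ := hpe ζ hζ
  obtain ⟨-, ha, hall⟩ := haF ζ' (hζ'.trans hγ)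
  obtain ⟨α, hα, hα'⟩ := hbad (a ζ') ha
  exact absurd ((((hp ζ' hζ').2 α hα).trans hpζ).trans (le_max_left _ _))
    (not_le.2 (hα' (hle.trans_lt (hall α hα).1) ((hall α hα).2.trans_lt (hcl ζ' hζ'))))

/-- The main unboundedness property of `walkMax`. -/
theorem exists_walkMax_eq (hC : IsCoherentSeq κ C) (hχ : χ.IsRegular) (hθ : θ.IsRegular)
    (hκ : κ.IsRegular) (hχθ : χ ≤ θ) (hκ₁ : Cardinal.aleph 1 < κ) (hθκ : θ < κ)
    (hidx : ∀ x, idx x < θ.ord) {ζ₀ : Ordinal.{u}} (hζ₀ : ζ₀ < κ.ord)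
    (hidx₀ : ∀ x η, ζ₀ ≤ η → idx (x ∩ Set.Iio η) = idx x)
    (hstat : ∀ i < θ.ord, StatIn κ {γ | idx (C γ) = i})
    (hσ : σ < χ.ord) (h𝒜 : IsDisjointFamily κ σ 𝒜) {ε ε' : Ordinal.{u}} (hε : ε < θ.ord)
    (hε' : ε' < κ.ord) :
    ∃ a ∈ 𝒜, ∃ b ∈ 𝒜, (∀ α ∈ a, ∀ β ∈ b, α < β) ∧ ∃ M : Ordinal.{u} ×ₗ Ordinal.{u},
      ε < (ofLex M).1 ∧ ε' < (ofLex M).2 ∧ ∀ α ∈ a, ∀ β ∈ b, walkMax C idx α β = M := by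
  obtain ⟨Λ, hΛ, e, he, hup⟩ := hC.exists_uniform_walkMax_above hχ hθ hκ hχθ (hχθ.trans_lt hθκ) hθκ hidx hσ h𝒜
  obtain ⟨e', he', hlow⟩ := exists_walkMax_le_below (C := C) hχθ hθ hκ hκ₁ hθκ hidx hσ h𝒜
  choose! G hG hηG hidxG hGa using hlow
  have hm : max ε (max e e') < θ.ord := max_lt hε (max_lt he he')
  set i := Order.succ (max ε (max e e')) with hi
  have hiθ : i < θ.ord := (Cardinal.isSuccLimit_ord hθ.aleph0_le).succ_lt hm
  have hilt := Order.lt_succ (max ε (max e e'))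
  rw [← hi, max_lt_iff, max_lt_iff] at hilt
  obtain ⟨ν, hνi, hν, hltν, -, hcl⟩ := (hstat i hiθ).exists_closed_gt hκ hG
    (max_lt (max_lt hΛ hζ₀) hε')
  rw [max_lt_iff, max_lt_iff] at hltν
  have hν0 : 0 < ν := pos_of_gt hltν.2
  obtain ⟨δ, hδ, hνδ, b, hb, hball⟩ := hup ν hν
  obtain ⟨ζ, hζ, hsplit⟩ := hC.exists_walkSup_eq (fun x n => toLex (idx x, n)) hν0 δ hδ hνδ.le
  set η := max ζ (max (max Λ ζ₀) ε') with hη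
  have hην : η < ν := max_lt hζ (max_lt (max_lt hltν.1.1 hltν.1.2) hltν.2)
  have hηκ : η < κ.ord := hην.trans hν
  set γ := G η
  have hγν : γ < ν := hcl η hην
  have hηγ : η < γ := hηG η hηκ
  have hηγ' := hηγ
  rw [hη, max_lt_iff, max_lt_iff, max_lt_iff] at hηγ'
  obtain ⟨hζγ, ⟨hΛγ, hζ₀γ⟩, hεγ⟩ := hηγ'
  have hγ0 : 0 < γ := pos_of_gt hηγ
  obtain ⟨ζ', hζ', hsplit'⟩ := hC.exists_walkSup_eq (fun x n => toLex (idx x, n)) hγ0 δ hδ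
    (hγν.trans hνδ).le
  obtain ⟨a, ha, haall⟩ := hGa η hηκ (max ζ' Λ) (max_lt hζ' hΛγ)
  have hLν := hC.ladder ν hν
  -- Otherwise C γ = C ν ∩ γ would have index i, since γ > ζ₀, although its index is at most e' < i.
  have hs : sSup (C ν ∩ Set.Iio γ) < γ := by
    refine (sSup_inter_Iio_le _ _).lt_of_ne fun hs => ?_
    have hacc : IsAccPt (C ν) γ := ⟨hγ0, hs⟩
    have := hidxG η hηκ
    change idx (C γ) ≤ e' at this
    rw [← hC.coherent ν hν γ ⟨hLν.closed γ hγν hacc, hacc⟩, hidx₀ _ _ hζ₀γ.le, hνi] at this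
    exact absurd hilt.2.2 (not_lt.2 this)
  have hiM : i ≤ (ofLex (walkMax C idx γ δ)).1 := by
    have h1 : toLex (i, nextStep C γ ν) ≤ walkMax C idx γ δ := by
      unfold walkMax
      rw [hsplit γ hζγ hγν, walkSup_of_lt hLν hγν hs, hidx₀ _ _ hζ₀γ.le, hνi]
      exact le_sup_of_le_right le_sup_left
    exact Prod.Lex.monotone_fst_ofLex h1
  refine ⟨a, ha, b, hb, fun α hα β hβ => ?_, walkMax C idx γ δ, hilt.1.trans_le hiM,
    hεγ.trans_le (le_walkMax_snd hC hδ ((zero_le (a := ε)).trans_lt (hilt.1.trans_le hiM))),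
    fun α hα β hβ => ?_⟩
  · exact ((haall α hα).2.1.trans (hγν.trans hνδ)).trans (hball β hβ).1
  · obtain ⟨h1, h2, h3⟩ := haall α hα
    rw [max_lt_iff] at h1
    obtain ⟨-, h4, h5⟩ := hball β hβ
    have h6 : walkMax C idx α δ = walkMax C idx γ δ ⊔ walkMax C idx α γ := hsplit' α h1.1 h2
    rw [h5 α h1.2 (h2.trans (hγν.trans hνδ)), h6,
      sup_eq_left.2 (le_of_fst_lt ((h3.trans_lt hilt.2.2).trans_le hiM)),
      sup_eq_right.2 (le_of_fst_lt ((h4.trans_lt hilt.2.1).trans_le hiM))]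

end IsCoherentSeq

theorem image_uncurry_prod_eq_singleton {c : Ordinal.{u} → Ordinal.{u} → Ordinal.{u}}
    {a b : Set Ordinal.{u}} {τ : Ordinal.{u}} (ha : a.Nonempty) (hb : b.Nonempty)
    (h : ∀ α ∈ a, ∀ β ∈ b, c α β = τ) : Function.uncurry c '' (a ×ˢ b) = {τ} := by
  refine Set.Subset.antisymm ?_ ?_
  · rintro _ ⟨⟨α, β⟩, ⟨hα, hβ⟩, rfl⟩
    exact h α hα β hβ
  · rintro _ rfl
    obtain ⟨α, hα⟩ := ha
    obtain ⟨β, hβ⟩ := hb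
    exact ⟨(α, β), ⟨hα, hβ⟩, h α hα β hβ⟩

theorem theoremB (χ θ κ : Cardinal.{u}) (hχ : χ.IsRegular) (hθ : θ.IsRegular) (hκ : κ.IsRegular)
    (hχθ : χ ≤ θ) (hθκ : θ ≤ κ) (hmax : max χ (Cardinal.aleph 1) < κ) (hsq : Square κ) :
    UOneTwo κ θ χ := by
  rw [max_lt_iff] at hmax
  obtain ⟨C, hC, hnt⟩ := hsq.exists_coherentSeq
  rcases hθκ.lt_or_eq with hlt | rfl
  · obtain ⟨ζ₀, hζ₀, idx, hidx, hidx₀, hstat⟩ := hC.exists_index hκ hnt hθ hlt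
    refine ⟨fun α β => (ofLex (walkMax C idx α β)).1,
      fun α β _ _ => walkMax_fst_lt hθ.ord_pos hidx, fun σ hσ 𝒜 h𝒜 ε hε => ?_⟩
    obtain ⟨a, ha, b, hb, hab, M, hM, -, h⟩ := hC.exists_walkMax_eq hχ hθ hκ hχθ hmax.2 hlt hidx
      hζ₀ hidx₀ hstat hσ h𝒜 hε hκ.ord_pos
    exact ⟨a, ha, b, hb, hab, _, hM, image_uncurry_prod_eq_singleton (h𝒜.nonempty hκ ha)
      (h𝒜.nonempty hκ hb) fun α hα β hβ => by rw [h α hα β hβ]⟩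
  -- For θ = κ there need not be κ many indices: χ < κ of them make `walkMax` constant, and the next
  -- step gives unbounded colours.
  · obtain ⟨ζ₀, hζ₀, idx, hidx, hidx₀, hstat⟩ := hC.exists_index hκ hnt hχ hmax.1
    refine ⟨fun α β => (ofLex (walkMax C idx α β)).2,
      fun α β _ hβ => walkMax_snd_lt hκ.ord_pos hβ, fun σ hσ 𝒜 h𝒜 ε hε => ?_⟩
    obtain ⟨a, ha, b, hb, hab, M, -, hM, h⟩ := hC.exists_walkMax_eq hχ hχ hκ le_rfl hmax.2 hmax.1
      hidx hζ₀ hidx₀ hstat hσ h𝒜 hχ.ord_pos hε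
    exact ⟨a, ha, b, hb, hab, _, hM, image_uncurry_prod_eq_singleton (h𝒜.nonempty hκ ha)
      (h𝒜.nonempty hκ hb) fun α hα β hβ => by rw [h α hα β hβ]⟩
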